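/- Let $\mathbb N=\{1,2,\dots\}$; $[M]$ denotes the set of infinite subsets of $M\subset\mathbb N$, $[M]^{<\omega}$ the set of its finite subsets, and $M(n)$ the $n$-th smallest element of $M\in[\mathbb N]$. For finite nonempty sets write $E<F$ if $\max E<\min F$, and $n\le E$ if $n\le \min E$. **Schreier families.** For every countable limit ordinal $\xi$ fix a strictly increasing sequence $(\xi_n)_{n\ge1}$ of ordinals with supremum $\xi$, such that the families defined as follows satisfy $\mathcal S_{\xi_n+1}\subset\mathcal S_{\xi_{n+1}}$ for all $n$ (such choices exist; the statement holds for every such choice): $\mathcal S_0=\{\varnothing\}\cup\{\{n\}:n\in\mathbb N\}$; $$\mathcal S_{\xi+1}=\{\varnothing\}\cup\Bigl\{\bigcup_{i=1}^kE_i:\ k\le E_1<\dots<E_k,\ \varnothing\ne E_i\in\mathcal S_\xi\Bigr\};$$ and for limit $\xi<\omega_1$, $\mathcal S_\xi=\{\varnothing\}\cup\{E\neq\varnothing:\ \exists n\le E,\ E\in\mathcal S_{\xi_n+1}\}$. **Repeated averages.** For $\xi<\omega_1$, $M\in[\mathbb N]$, $n\in\mathbb N$ define finitely supported functions $\mathbb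 S^\xi_{M,n}:\mathbb N\to[0,1]$ by recursion. $\mathbb S^0_{M,n}$ is the indicator function of $\{M(n)\}$. For $\xi\ge 1$ put, by recursion on $n$, $M_n=M\setminus\bigcup_{i<n}\operatorname{supp}\mathbb S^{\xi}_{M,i}$ and $m=\min M_n$; then $$\mathbb S^{\zeta+1}_{M,n}=\frac1{m}\sum_{j=1}^{m}\mathbb S^\zeta_{M_n,j}\quad(\xi=\zeta+1),\qquad \mathbb S^\xi_{M,n}=\mathbb S^{\xi_{m}+1}_{M_n,1}\quad(\xi\text{ limit}).$$ **Schreier spaces.** Let $\mathbb K\in\{\mathbb R,\mathbb C\}$. $X_\xi$ is the completion of $c_{00}$ (finitely supported $\mathbb K$-valued sequences) in the norm $\|x\|_\xi=\sup_{E\in\mathcal S_\xi}\sum_{i\in E}|x(i)|$, and $(e_i)$ is its canonical basis. **Lemma.** Let $\xi<\omega_1$ and $M\in[\mathbb N]$. 1. For every $i$ the series $\sum_{n}\mathbb S^\xi_{M,n}(i)$ converges, and for every nonempty $F\in\mathcal S_\xi$ with $F\subset M$, $$\Bigl\|F\sum_{n=1}^\infty\sum_{i=1}^\infty\mathbb S^\xi_{M,n}(i)e_i\Bigr\|_{\ell_1}=\sum_{i\in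 F}\Bigl|\sum_{n=1}^\infty\mathbb S^\xi_{M,n}(i)\Bigr|\le 6 .$$ 2. Consequently, the sequence $x_n=\sum_{i=1}^\infty\mathbb S^\xi_{M,n}(i)e_i$ $(n\in\mathbb N)$ is weakly $1$-summing in $X_\xi$ with constant $6$, i.e. $(x_n)\in 6B_{\ell_1^w(X_\xi)}$: $\sum_{n=1}^\infty|f(x_n)|\le 6$ for every $f\in X_\xi^*$ with $\|f\|\le1$. -/

import Mathlib

open scoped Ordinal

noncomputable section

namespace Schreier

/-! ### Infinite sets of positive integers

The natural numbers are the positive integers, `ℕ+`.  Infinite subsets are elements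
`M : Set ℕ+` with `M.Infinite`. -/

/-- `elem M n` is `M(n)`, the `n`-th smallest member of the infinite set `M` (`n = 1, 2, …`). -/
def elem (M : Set ℕ+) (n : ℕ+) : ℕ+ :=
  (Nat.nth (fun k => k.succPNat ∈ M) n.natPred).succPNat

/-- `minElem M` is `min M`. -/
def minElem (M : Set ℕ+) : ℕ+ := elem M 1

/-! ### Schreier families -/

/-- The successor step: `∅` and all unions `E₁ ∪ … ∪ E_k` with `k ≤ E₁ < … < E_k` and
`E_i` nonempty members of `𝓕`. -/
def succFamily (𝓕 : Set (Finset ℕ+)) : Set (Finset ℕ+) :=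
  {∅} ∪ {E | ∃ (k : ℕ) (P : Fin k → Finset ℕ+),
    (∀ i, (P i).Nonempty ∧ P i ∈ 𝓕) ∧
    (∀ i, ∀ a ∈ P i, k ≤ (a : ℕ)) ∧
    (∀ i j, i < j → ∀ a ∈ P i, ∀ b ∈ P j, a < b) ∧
    E = Finset.univ.biUnion P}

/-- The Schreier families `𝓢_ξ` built from an assignment `ξ ↦ (ξ_n)` of sequences of ordinals
to limit ordinals.  At a limit `ξ`, a nonempty `E` belongs to `𝓢_ξ` if `n ≤ E ∈ 𝓢_{ξ_n + 1}`
for some `n`. -/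
def family (seq : Ordinal.{0} → ℕ+ → Ordinal.{0}) (ξ : Ordinal.{0}) : Set (Finset ℕ+) :=
  Ordinal.limitRecOn (motive := fun _ => Set (Finset ℕ+)) ξ
    ({∅} ∪ {E | ∃ n : ℕ+, E = {n}})
    (fun _ 𝓕 => succFamily 𝓕)
    (fun ξ _ 𝓕 => {∅} ∪ {E | E.Nonempty ∧ ∃ n : ℕ+, (∀ a ∈ E, n ≤ a) ∧
      ∃ h : seq ξ n + 1 < ξ, E ∈ 𝓕 (seq ξ n + 1) h})

/-- An admissible choice of fundamental sequences: for every countable limit ordinal `ξ`, a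
sequence `ξ_n ↑ ξ` such that `𝓢_{ξ_n + 1} ⊆ 𝓢_{ξ_{n+1}}` for all `n`. -/
structure FundamentalSequences where
  seq : Ordinal.{0} → ℕ+ → Ordinal.{0}
  strictMono : ∀ ξ, Order.IsSuccLimit ξ → ξ < ω₁ → StrictMono (seq ξ)
  isLUB : ∀ ξ, Order.IsSuccLimit ξ → ξ < ω₁ → IsLUB (Set.range (seq ξ)) ξ
  nested : ∀ ξ, Order.IsSuccLimit ξ → ξ < ω₁ → ∀ n,
    family seq (seq ξ n + 1) ⊆ family seq (seq ξ (n + 1))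

theorem family_zero (seq : Ordinal.{0} → ℕ+ → Ordinal.{0}) :
    family seq 0 = {∅} ∪ {E | ∃ n : ℕ+, E = {n}} := by
  simp [family]

theorem family_succ (seq : Ordinal.{0} → ℕ+ → Ordinal.{0}) (ξ : Ordinal.{0}) :
    family seq (ξ + 1) = succFamily (family seq ξ) := by
  simp [family]

theorem family_limit (seq : Ordinal.{0} → ℕ+ → Ordinal.{0}) {ξ : Ordinal.{0}}
    (hξ : Order.IsSuccLimit ξ) :
    family seq ξ = {∅} ∪ {E | E.Nonempty ∧ ∃ n : ℕ+, (∀ a ∈ E, n ≤ a) ∧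
      seq ξ n + 1 < ξ ∧ E ∈ family seq (seq ξ n + 1)} := by
  unfold family
  rw [Ordinal.limitRecOn_limit _ _ _ _ hξ]
  simp only [exists_prop]

theorem seq_lt {c : ℕ+ → Ordinal.{0}} {ξ : Ordinal.{0}} (hc : StrictMono c)
    (hl : IsLUB (Set.range c) ξ) (n : ℕ+) : c n < ξ :=
  (hc (PNat.lt_add_right n 1)).trans_le (hl.1 ⟨n + 1, rfl⟩)

theorem singleton_mem_succFamily {𝓕 : Set (Finset ℕ+)} {n : ℕ+} (h : {n} ∈ 𝓕) :
    {n} ∈ succFamily 𝓕 := by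
  refine Or.inr ⟨1, fun _ => {n}, fun _ => ⟨by simp, h⟩, ?_, ?_, by simp⟩
  · intro _ a _
    exact a.pos
  · intro i j hij
    omega

theorem singleton_mem_family (seq : Ordinal.{0} → ℕ+ → Ordinal.{0}) (ξ : Ordinal.{0})
    (h : ∀ ζ ≤ ξ, Order.IsSuccLimit ζ → StrictMono (seq ζ) ∧ IsLUB (Set.range (seq ζ)) ζ)
    (n : ℕ+) : {n} ∈ family seq ξ := by
  induction ξ using WellFoundedLT.induction with
  | ind ξ ih =>
    rcases Ordinal.zero_or_succ_or_isSuccLimit ξ with rfl | ⟨ζ, rfl⟩ | hξ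
    · rw [family_zero]
      exact Or.inr ⟨n, rfl⟩
    · rw [Order.succ_eq_add_one] at ih h ⊢
      rw [family_succ]
      have hζ : ζ < ζ + 1 := Order.lt_add_one_iff.2 le_rfl
      exact singleton_mem_succFamily (ih ζ hζ fun η hη => h η (hη.trans hζ.le))
    · rw [family_limit seq hξ]
      have hs := h ξ le_rfl hξ
      have h1 : seq ξ 1 + 1 < ξ := hξ.add_one_lt (seq_lt hs.1 hs.2 1)
      exact Or.inr ⟨by simp, 1, by simp, h1, ih _ h1 fun η hη => h η (hη.trans h1.le)⟩

namespace FundamentalSequences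

/-- The Schreier family `𝓢_ξ` attached to the choice `s` of fundamental sequences. -/
def S (s : FundamentalSequences) (ξ : Ordinal.{0}) : Set (Finset ℕ+) := family s.seq ξ

theorem singleton_mem (s : FundamentalSequences) {ξ : Ordinal.{0}} (hξ : ξ < ω₁) (n : ℕ+) :
    {n} ∈ s.S ξ :=
  singleton_mem_family s.seq ξ
    (fun ζ hζ hl => ⟨s.strictMono ζ hl (hζ.trans_lt hξ), s.isLUB ζ hl (hζ.trans_lt hξ)⟩) n

end FundamentalSequences

/-! ### Repeated averages -/

/-- Given a rule `first` assigning a finitely supported function to each infinite set, put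
`M_1 = M`, `M_{n+1} = M_n \ supp (first M_n)`; `peel first M n` is `first M_n`.  In other words
`M_n = M \ ⋃_{i<n} supp (peel first M i)`. -/
def peel (first : Set ℕ+ → (ℕ+ →₀ ℝ)) (M : Set ℕ+) (n : ℕ+) : ℕ+ →₀ ℝ :=
  first ((fun N => N \ ((first N).support : Set ℕ+))^[n.natPred] M)

/-- The repeated averages `𝕊^ξ_{M,n}`, as finitely supported functions on `ℕ+`.
* `𝕊^0_{M,n}` is the indicator function of `{M(n)}`;
* `𝕊^{ξ+1}_{M,n} = (1 / min M_n) ∑_{j=1}^{min M_n} 𝕊^ξ_{M_n,j}`;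
* `𝕊^ξ_{M,n} = 𝕊^{ξ_m + 1}_{M_n,1}`, where `m = min M_n`, for a limit ordinal `ξ`,

where `M_n = M \ ⋃_{i<n} supp 𝕊_{M,i}` (for the order being defined). -/
def average (s : FundamentalSequences) (ξ : Ordinal.{0}) : Set ℕ+ → ℕ+ → (ℕ+ →₀ ℝ) :=
  Ordinal.limitRecOn (motive := fun _ => Set ℕ+ → ℕ+ → (ℕ+ →₀ ℝ)) ξ
    (fun M n => Finsupp.single (elem M n) 1)
    (fun _ A => peel fun N =>
      (1 / (minElem N : ℝ)) • ∑ j ∈ Finset.Icc 1 (minElem N), A N j)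
    (fun ξ _ A => peel fun N =>
      open Classical in
      if h : s.seq ξ (minElem N) + 1 < ξ then A (s.seq ξ (minElem N) + 1) h N 1 else 0)

/-- The formal sum `∑_n ∑_i 𝕊^ξ_{M,n}(i) e_i`, as a scalar sequence (coordinatewise sum). -/
def fullSum (s : FundamentalSequences) (ξ : Ordinal.{0}) (M : Set ℕ+) (i : ℕ+) : ℝ :=
  ∑' n : ℕ+, average s ξ M n i

/-! ### Schreier spaces -/

/-- `‖x‖_ξ = sup_{E ∈ 𝓢_ξ} ‖E x‖_{ℓ₁}` for `x ∈ c₀₀`. -/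
def schreierNorm (s : FundamentalSequences) (ξ : Ordinal.{0}) {𝕜 : Type*} [RCLike 𝕜]
    (x : ℕ+ →₀ 𝕜) : ℝ :=
  ⨆ E : s.S ξ, ∑ i ∈ (E : Finset ℕ+), ‖x i‖

/-- `c₀₀`, equipped with the Schreier norm of order `ξ`. -/
def C00 (_s : FundamentalSequences) {ξ : Ordinal.{0}} (_hξ : ξ < ω₁) (𝕜 : Type*) [RCLike 𝕜] :
    Type _ := ℕ+ →₀ 𝕜

section Norm

variable (s : FundamentalSequences) {ξ : Ordinal.{0}} (hξ : ξ < ω₁) (𝕜 : Type*) [RCLike 𝕜]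

instance : AddCommGroup (C00 s hξ 𝕜) := inferInstanceAs (AddCommGroup (ℕ+ →₀ 𝕜))

instance : Module 𝕜 (C00 s hξ 𝕜) := inferInstanceAs (Module 𝕜 (ℕ+ →₀ 𝕜))

instance : Norm (C00 s hξ 𝕜) := ⟨fun x => schreierNorm s ξ (𝕜 := 𝕜) x⟩

theorem bddAbove_norm (ξ : Ordinal.{0}) {𝕜 : Type*} [RCLike 𝕜] (x : ℕ+ →₀ 𝕜) :
    BddAbove (Set.range fun E : s.S ξ => ∑ i ∈ (E : Finset ℕ+), ‖x i‖) := by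
  refine ⟨∑ i ∈ x.support, ‖x i‖, ?_⟩
  rintro _ ⟨E, rfl⟩
  have h1 : ∑ i ∈ (E : Finset ℕ+), ‖x i‖ ≤ ∑ i ∈ (E : Finset ℕ+) ∪ x.support, ‖x i‖ :=
    Finset.sum_le_sum_of_subset_of_nonneg Finset.subset_union_left
      fun i _ _ => norm_nonneg _
  refine h1.trans (le_of_eq (Finset.sum_subset Finset.subset_union_right ?_).symm)
  intro i _ hi
  simpa using hi

theorem schreierNorm_add_le {ξ : Ordinal.{0}} (hξ : ξ < ω₁) {𝕜 : Type*} [RCLike 𝕜] (x y : ℕ+ →₀ 𝕜) :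
    schreierNorm s ξ (x + y) ≤ schreierNorm s ξ x + schreierNorm s ξ y := by
  have : Nonempty (s.S ξ) := ⟨⟨{1}, s.singleton_mem hξ 1⟩⟩
  refine ciSup_le fun E => ?_
  refine le_trans (Finset.sum_le_sum fun i _ => norm_add_le _ _) ?_
  rw [Finset.sum_add_distrib]
  exact add_le_add (le_ciSup (bddAbove_norm s ξ x) E) (le_ciSup (bddAbove_norm s ξ y) E)

theorem schreierNorm_smul (ξ : Ordinal.{0}) {𝕜 : Type*} [RCLike 𝕜] (c : 𝕜) (x : ℕ+ →₀ 𝕜) :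
    schreierNorm s ξ (c • x) = ‖c‖ * schreierNorm s ξ x := by
  unfold schreierNorm
  rw [Real.mul_iSup_of_nonneg (norm_nonneg c)]
  refine iSup_congr fun E => ?_
  rw [Finset.mul_sum]
  exact Finset.sum_congr rfl fun i _ => norm_mul c _

theorem schreierNorm_eq_zero_iff {ξ : Ordinal.{0}} (hξ : ξ < ω₁) {𝕜 : Type*} [RCLike 𝕜] (x : ℕ+ →₀ 𝕜) :
    schreierNorm s ξ x = 0 ↔ x = 0 := by
  constructor
  · intro hx
    ext i
    have h1 := le_ciSup (bddAbove_norm s ξ x) ⟨{i}, s.singleton_mem hξ i⟩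
    change _ ≤ schreierNorm s ξ x at h1
    rw [hx] at h1
    simpa using h1
  · rintro rfl
    simp [schreierNorm]

theorem normCore : NormedSpace.Core 𝕜 (C00 s hξ 𝕜) where
  norm_nonneg _ := Real.iSup_nonneg fun _ => Finset.sum_nonneg fun _ _ => norm_nonneg _
  norm_smul c x := schreierNorm_smul s ξ c x
  norm_triangle x y := schreierNorm_add_le s hξ (𝕜 := 𝕜) x y
  norm_eq_zero_iff x := schreierNorm_eq_zero_iff s hξ (𝕜 := 𝕜) x

instance : NormedAddCommGroup (C00 s hξ 𝕜) := NormedAddCommGroup.ofCore (normCore s hξ 𝕜)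

instance : NormedSpace 𝕜 (C00 s hξ 𝕜) := NormedSpace.ofCore (normCore s hξ 𝕜)

/-- The Schreier space `X_ξ`, the completion of `c₀₀` in the norm `‖·‖_ξ`. -/
abbrev X : Type _ := UniformSpace.Completion (C00 s hξ 𝕜)

/-- The canonical basis vector `e_i` of `X_ξ`. -/
def e (i : ℕ+) : X s hξ 𝕜 :=
  ((show C00 s hξ 𝕜 from Finsupp.single i 1 : C00 s hξ 𝕜) : X s hξ 𝕜)

/-- The vector `∑_i 𝕊^ξ_{M,n}(i) e_i` of `X_ξ` (a finite sum, over the support). -/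
def averageVec (M : Set ℕ+) (n : ℕ+) : X s hξ 𝕜 :=
  (average s ξ M n).sum fun i a => (a : 𝕜) • e s hξ 𝕜 i

end Norm

/-- The sequence `(x_n)` is weakly `1`-summing with constant `C`, i.e. it belongs to
`C · B_{ℓ₁^w(E)}`: `∑_n |f(x_n)| ≤ C` for every functional `f` of norm at most `1`. -/
def WeaklySummingWith (𝕜 : Type*) [RCLike 𝕜] {E : Type*} [NormedAddCommGroup E] [NormedSpace 𝕜 E]
    (C : ℝ) (x : ℕ+ → E) : Prop :=
  ∀ f : StrongDual 𝕜 E, ‖f‖ ≤ 1 → Summable (fun n => ‖f (x n)‖) ∧ ∑' n, ‖f (x n)‖ ≤ C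

/-! ### Existence of admissible fundamental sequences -/

theorem mem_singleton_of_one_mem (seq : Ordinal.{0} → ℕ+ → Ordinal.{0}) (ξ : Ordinal.{0})
    (E : Finset ℕ+) (hE : E ∈ family seq ξ) (h1 : 1 ∈ E) : E = {1} := by
  induction ξ using WellFoundedLT.induction generalizing E with
  | ind ξ ih =>
    rcases Ordinal.zero_or_succ_or_isSuccLimit ξ with rfl | ⟨ζ, rfl⟩ | hξ
    · rw [family_zero] at hE
      rcases hE with rfl | ⟨n, rfl⟩
      · simp at h1
      · simp at h1; simp [h1]
    · rw [Order.succ_eq_add_one] at ih hE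
      rw [family_succ] at hE
      rcases hE with rfl | ⟨k, P, hP, hk, hlt, rfl⟩
      · simp at h1
      · have h1' := h1
        rw [Finset.mem_biUnion] at h1'
        obtain ⟨i, -, hi⟩ := h1'
        have hk1 : k ≤ 1 := by simpa using hk i 1 hi
        have : k = 1 := by have := i.2; omega
        subst this
        have e : Finset.univ.biUnion P = P i := by
          ext a; simp [Subsingleton.elim i 0]
        rw [e]
        exact ih ζ (Order.lt_add_one_iff.2 le_rfl) _ (hP i).2 hi
    · rw [family_limit seq hξ] at hE
      rcases hE with rfl | ⟨-, n, hn, hlt, hm⟩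
      · simp at h1
      · exact ih _ hlt _ hm h1

theorem mem_succFamily {𝓕 : Set (Finset ℕ+)} {E : Finset ℕ+} (h : E ∈ 𝓕) :
    E ∈ succFamily 𝓕 := by
  rcases E.eq_empty_or_nonempty with rfl | hE
  · exact Or.inl rfl
  refine Or.inr ⟨1, fun _ => E, fun _ => ⟨hE, h⟩, ?_, ?_, by simp⟩
  · intro _ a _
    exact a.pos
  · intro i j hij
    omega

theorem empty_mem (seq : Ordinal.{0} → ℕ+ → Ordinal.{0}) (ξ : Ordinal.{0}) :
    ∅ ∈ family seq ξ := by
  rcases Ordinal.zero_or_succ_or_isSuccLimit ξ with rfl | ⟨ζ, rfl⟩ | hξ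
  · rw [family_zero]; exact Or.inl rfl
  · rw [Order.succ_eq_add_one, family_succ]; exact Or.inl rfl
  · rw [family_limit seq hξ]; exact Or.inl rfl

theorem hereditary (seq : Ordinal.{0} → ℕ+ → Ordinal.{0}) (ξ : Ordinal.{0})
    (E F : Finset ℕ+) (hE : E ∈ family seq ξ) (hF : F ⊆ E) : F ∈ family seq ξ := by
  induction ξ using WellFoundedLT.induction generalizing E F with
  | ind ξ ih =>
    rcases F.eq_empty_or_nonempty with rfl | hF0
    · exact empty_mem seq ξ
    rcases Ordinal.zero_or_succ_or_isSuccLimit ξ with rfl | ⟨ζ, rfl⟩ | hξ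
    · rw [family_zero] at hE ⊢
      rcases hE with rfl | ⟨n, rfl⟩
      · exact Or.inl (Finset.subset_empty.1 hF)
      · exact Or.inr ⟨n, (Finset.subset_singleton_iff.1 hF).resolve_left hF0.ne_empty⟩
    · rw [Order.succ_eq_add_one] at ih hE ⊢
      rw [family_succ] at hE ⊢
      rcases hE with rfl | ⟨k, P, hP, hk, hlt, rfl⟩
      · exact absurd (Finset.subset_empty.1 hF) hF0.ne_empty
      · right
        let T : Finset (Fin k) := Finset.univ.filter fun i => (P i ∩ F).Nonempty
        let o := T.orderEmbOfFin rfl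
        have ho : ∀ i, (P (o i) ∩ F).Nonempty := fun i =>
          (Finset.mem_filter.1 (T.orderEmbOfFin_mem rfl i)).2
        refine ⟨T.card, fun i => P (o i) ∩ F, ?_, ?_, ?_, ?_⟩
        · intro i
          exact ⟨ho i, ih ζ (Order.lt_add_one_iff.2 le_rfl) _ _ (hP (o i)).2
            Finset.inter_subset_left⟩
        · intro i a ha
          have : T.card ≤ k := by simpa using T.card_le_univ
          exact this.trans (hk (o i) a (Finset.mem_inter.1 ha).1)
        · intro i j hij a ha b hb
          exact hlt _ _ (o.strictMono hij) a (Finset.mem_inter.1 ha).1 b (Finset.mem_inter.1 hb).1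
        · ext a
          simp only [Finset.mem_biUnion, Finset.mem_univ, true_and, Finset.mem_inter]
          constructor
          · intro ha
            obtain ⟨i, -, hi⟩ := Finset.mem_biUnion.1 (hF ha)
            have hT : i ∈ Set.range o := by
              rw [Finset.range_orderEmbOfFin]
              simp only [T, Finset.coe_filter, Finset.mem_univ, true_and, Set.mem_ofPred_eq]
              exact ⟨a, Finset.mem_inter.2 ⟨hi, ha⟩⟩
            obtain ⟨j, rfl⟩ := hT
            exact ⟨j, hi, ha⟩
          · rintro ⟨i, -, h⟩; exact h
    · rw [family_limit seq hξ] at hE ⊢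
      rcases hE with rfl | ⟨-, n, hn, hlt, hm⟩
      · exact absurd (Finset.subset_empty.1 hF) hF0.ne_empty
      · exact Or.inr ⟨hF0, n, fun a ha => hn a (hF ha), hlt, ih _ hlt _ _ hm hF⟩

/-- The sequences attached to the limit ordinals below `ξ` increase to their index. -/
def Good (seq : Ordinal.{0} → ℕ+ → Ordinal.{0}) (ξ : Ordinal.{0}) : Prop :=
  ∀ ζ < ξ, Order.IsSuccLimit ζ → StrictMono (seq ζ) ∧ IsLUB (Set.range (seq ζ)) ζ

theorem almost (seq : Ordinal.{0} → ℕ+ → Ordinal.{0}) (ξ : Ordinal.{0})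
    (h : Good seq (ξ + 1)) (α : Ordinal.{0}) (hα : α ≤ ξ) :
    ∃ m : ℕ+, ∀ E ∈ family seq α, (∀ a ∈ E, m ≤ a) → E ∈ family seq ξ := by
  induction ξ using WellFoundedLT.induction with
  | ind ξ ih =>
    rcases hα.eq_or_lt with rfl | hα
    · exact ⟨1, fun E hE _ => hE⟩
    rcases Ordinal.zero_or_succ_or_isSuccLimit ξ with rfl | ⟨ζ, rfl⟩ | hξ
    · exact absurd hα (not_lt_bot)
    · rw [Order.succ_eq_add_one] at *
      have hl : ζ < ζ + 1 := Order.lt_add_one_iff.2 le_rfl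
      obtain ⟨m, hm⟩ := ih ζ hl (fun η hη => h η (hη.trans (Order.lt_add_one_iff.2 le_rfl)))
        (Order.lt_add_one_iff.1 hα)
      refine ⟨m, fun E hE hE' => ?_⟩
      rw [family_succ]
      exact mem_succFamily (hm E hE hE')
    · obtain ⟨hs, hlub⟩ := h ξ (Order.lt_add_one_iff.2 le_rfl) hξ
      obtain ⟨_, ⟨n, rfl⟩, hn⟩ := (lt_isLUB_iff hlub).1 hα
      have hnξ := seq_lt hs hlub n
      obtain ⟨m, hm⟩ := ih (seq ξ n) hnξ
        (fun η hη => h η (hη.trans_le (Order.add_one_le_of_lt (hnξ.trans (Order.lt_add_one_iff.2 le_rfl))))) hn.le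
      refine ⟨max m n, fun E hE hE' => ?_⟩
      have h1 := hm E hE fun a ha => (le_max_left _ _).trans (hE' a ha)
      rw [family_limit seq hξ]
      rcases E.eq_empty_or_nonempty with rfl | hE0
      · exact Or.inl rfl
      refine Or.inr ⟨hE0, n, fun a ha => (le_max_right _ _).trans (hE' a ha),
        hξ.add_one_lt hnξ, ?_⟩
      rw [family_succ]
      exact mem_succFamily h1

theorem insert_mem {𝓕 : Set (Finset ℕ+)} {E : Finset ℕ+} {a : ℕ+} (h2 : 2 ≤ a)
    (ha : {a} ∈ 𝓕) (hE : E ∈ 𝓕) (h : ∀ b ∈ E, a < b) : insert a E ∈ succFamily 𝓕 := by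
  rcases E.eq_empty_or_nonempty with rfl | hE0
  · exact mem_succFamily ha
  have h2' : 2 ≤ (a : ℕ) := h2
  refine Or.inr ⟨2, ![{a}, E], ?_, ?_, ?_, ?_⟩
  · intro i; fin_cases i
    · exact ⟨by simp, ha⟩
    · exact ⟨hE0, hE⟩
  · intro i b hb; fin_cases i
    · have : b = a := by simpa using hb
      rw [this]; exact h2'
    · exact h2'.trans (h b (by simpa using hb)).le
  · intro i j hij x hx y hy
    fin_cases i <;> fin_cases j <;> simp at hij hx hy
    subst hx; exact h y hy
  · ext x; simp [Fin.exists_fin_two]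

theorem absorb (seq : Ordinal.{0} → ℕ+ → Ordinal.{0}) (β : Ordinal.{0})
    (hs : ∀ (j : ℕ) n, {n} ∈ family seq (β + j)) (m : ℕ+) (j : ℕ) (E : Finset ℕ+)
    (h2 : ∀ a ∈ E, 2 ≤ a) (hm : E.filter (m ≤ ·) ∈ family seq β)
    (hj : (E.filter (· < m)).card ≤ j) : E ∈ family seq (β + j) := by
  induction j generalizing E with
  | zero =>
    have : E.filter (m ≤ ·) = E := by
      rw [Finset.filter_eq_self]
      intro a ha
      by_contra hc
      have : a ∈ E.filter (· < m) := by simp [ha]; simpa using hc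
      rw [Finset.card_eq_zero.1 (Nat.le_zero.1 hj)] at this
      simp at this
    simpa [this] using hm
  | succ j ih =>
    have e : β + ((j + 1 : ℕ) : Ordinal.{0}) = β + j + 1 := by push_cast; rw [add_assoc]
    rw [e, family_succ]
    rcases E.eq_empty_or_nonempty with rfl | hE0
    · exact Or.inl rfl
    set a := E.min' hE0
    have haE : a ∈ E := E.min'_mem hE0
    by_cases ham : a < m
    · rw [← Finset.insert_erase haE]
      refine insert_mem (h2 a haE) (hs j a) (ih _ ?_ ?_ ?_) ?_
      · intro b hb; exact h2 b (Finset.mem_of_mem_erase hb)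
      · exact hereditary seq β _ _ hm (Finset.filter_subset_filter _ (Finset.erase_subset _ _))
      · rw [Finset.filter_erase, Finset.card_erase_of_mem (by simp [haE, ham])]
        omega
      · intro b hb
        exact E.min'_lt_of_mem_erase_min' hE0 hb
    · apply mem_succFamily
      refine ih E h2 hm ?_
      have : E.filter (· < m) = ∅ := by
        rw [Finset.filter_eq_empty_iff]
        intro b hb hbm
        exact ham ((E.min'_le b hb).trans_lt hbm)
      simp [this]

theorem step (seq : Ordinal.{0} → ℕ+ → Ordinal.{0}) (ξ : Ordinal.{0}) (hξ : Order.IsSuccLimit ξ)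
    (h : Good seq ξ) (α γ : Ordinal.{0}) (hα : α < ξ) (hγ : γ < ξ) :
    ∃ β < ξ, α < β ∧ γ ≤ β ∧ family seq (α + 1) ⊆ family seq β := by
  set β₀ := max (α + 1) γ
  have hβ₀ : β₀ < ξ := max_lt (hξ.add_one_lt hα) hγ
  have hg : ∀ ζ < ξ, Good seq (ζ + 1) := fun ζ hζ η hη =>
    h η ((Order.lt_add_one_iff.1 hη).trans_lt hζ)
  have hn : ∀ j : ℕ, β₀ + j < ξ := by
    intro j
    induction j with
    | zero => simpa using hβ₀
    | succ j ih =>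
      push_cast; rw [← add_assoc]; exact hξ.add_one_lt ih
  have hsing : ∀ ζ < ξ, ∀ n, {n} ∈ family seq ζ := fun ζ hζ n =>
    singleton_mem_family seq ζ (fun η hη => h η (hη.trans_lt hζ)) n
  obtain ⟨m, hm⟩ := almost seq β₀ (hg _ hβ₀) (α + 1) (le_max_left _ _)
  have hle : β₀ ≤ β₀ + (m : ℕ) := le_self_add
  refine ⟨β₀ + (m : ℕ), hn m, ?_, (le_max_right _ _).trans hle, ?_⟩
  · exact (Order.lt_add_one_iff.2 le_rfl).trans_le ((le_max_left _ _).trans hle)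
  intro E hE
  by_cases h1 : 1 ∈ E
  · rw [mem_singleton_of_one_mem seq _ E hE h1]
    exact hsing _ (hn m) 1
  refine absorb seq β₀ (fun j n => hsing _ (hn j) n) m m E ?_ ?_ ?_
  · intro a ha
    have : a ≠ 1 := fun h => h1 (h ▸ ha)
    exact lt_of_le_of_ne (one_le) this.symm
  · exact hm _ (hereditary seq _ _ _ hE (Finset.filter_subset _ _)) (by simp)
  · have : E.filter (· < m) ⊆ Finset.Icc 1 m := by
      intro a ha
      simp at ha ⊢
      exact ha.2.le
    simpa using Finset.card_le_card this

theorem exists_seq (seq : Ordinal.{0} → ℕ+ → Ordinal.{0}) (ξ : Ordinal.{0})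
    (hξ : Order.IsSuccLimit ξ) (hω : ξ < ω₁) (h : Good seq ξ) :
    ∃ c : ℕ+ → Ordinal.{0}, StrictMono c ∧ IsLUB (Set.range c) ξ ∧
      ∀ n, family seq (c n + 1) ⊆ family seq (c (n + 1)) := by
  have hc : (Set.Iio ξ).Countable := by
    rw [← Cardinal.le_aleph0_iff_set_countable, Cardinal.mk_Iio_ordinal, Cardinal.lift_le_aleph0]
    have : ξ.card < Cardinal.aleph 1 := by
      rw [← Cardinal.lt_ord, Cardinal.ord_aleph]
      exact hω
    rw [← Order.lt_succ_iff, Cardinal.succ_aleph0]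
    exact this
  have h0 : (Set.Iio ξ).Nonempty := ⟨0, hξ.bot_lt⟩
  obtain ⟨f, hf⟩ := hc.exists_eq_range h0
  have hfl : ∀ n, f n < ξ := fun n => by
    have : f n ∈ Set.Iio ξ := hf ▸ ⟨n, rfl⟩
    exact this
  choose! g hg1 hg2 hg3 hg4 using fun α γ hα hγ => step seq ξ hξ h α γ hα hγ
  let c : ℕ → Ordinal.{0} := fun n => Nat.rec (f 0) (fun n x => g x (f n)) n
  have hcs : ∀ n, c (n + 1) = g (c n) (f n) := fun n => rfl
  have hcl : ∀ n, c n < ξ := by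
    intro n
    induction n with
    | zero => exact hfl 0
    | succ n ih => rw [hcs]; exact hg1 _ _ ih (hfl n)
  have hmono : StrictMono c := strictMono_nat_of_lt_succ fun n => by
    rw [hcs]; exact hg2 _ _ (hcl n) (hfl n)
  refine ⟨fun n => c n.natPred, ?_, ?_, ?_⟩
  · intro a b hab
    exact hmono (PNat.natPred_lt_natPred.2 hab)
  · constructor
    · rintro _ ⟨n, rfl⟩
      exact (hcl _).le
    · intro u hu
      by_contra hlt
      rw [not_le] at hlt
      have : u ∈ Set.range f := hf ▸ hlt
      obtain ⟨n, rfl⟩ := this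
      have h1 : c (n + 2) ≤ f n := hu ⟨(n + 2).succPNat, by simp⟩
      have h2 : f n ≤ c (n + 1) := by rw [hcs]; exact hg3 _ _ (hcl n) (hfl n)
      have h3 := hmono (Nat.lt_succ_self (n + 1))
      exact absurd (h1.trans h2) (not_le.2 h3)
  · intro n
    have : (n + 1).natPred = n.natPred + 1 := by
      have := n.pos
      simp only [PNat.natPred, PNat.add_coe, PNat.one_coe]
      omega
    simp only [this]
    rw [hcs]
    exact hg4 _ _ (hcl _) (hfl _)

/-- The families `𝓢_ξ` together with the sequences `(ξ_n)`, constructed simultaneously. -/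
def build (ξ : Ordinal.{0}) : Set (Finset ℕ+) × (ℕ+ → Ordinal.{0}) :=
  Ordinal.limitRecOn (motive := fun _ => Set (Finset ℕ+) × (ℕ+ → Ordinal.{0})) ξ
    ({∅} ∪ {E | ∃ n : ℕ+, E = {n}}, fun _ => 0)
    (fun _ p => (succFamily p.1, fun _ => 0))
    (fun ξ _ p =>
      let fam : Ordinal.{0} → Set (Finset ℕ+) := fun o => {E | ∃ h : o < ξ, E ∈ (p o h).1}
      let c := Classical.epsilon fun c : ℕ+ → Ordinal.{0} => StrictMono c ∧ IsLUB (Set.range c) ξ ∧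
        ∀ n, fam (c n + 1) ⊆ fam (c (n + 1))
      ({∅} ∪ {E | E.Nonempty ∧ ∃ n : ℕ+, (∀ a ∈ E, n ≤ a) ∧ E ∈ fam (c n + 1)}, c))

def bseq (ξ : Ordinal.{0}) : ℕ+ → Ordinal.{0} := (build ξ).2

theorem build_limit {ξ : Ordinal.{0}} (hξ : Order.IsSuccLimit ξ) : build ξ =
      let fam : Ordinal.{0} → Set (Finset ℕ+) := fun o => {E | o < ξ ∧ E ∈ (build o).1}
      let c := Classical.epsilon fun c : ℕ+ → Ordinal.{0} => StrictMono c ∧ IsLUB (Set.range c) ξ ∧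
        ∀ n, fam (c n + 1) ⊆ fam (c (n + 1))
      ({∅} ∪ {E | E.Nonempty ∧ ∃ n : ℕ+, (∀ a ∈ E, n ≤ a) ∧ E ∈ fam (c n + 1)}, c) := by
  conv_lhs => unfold build
  rw [Ordinal.limitRecOn_limit _ _ _ _ hξ]
  simp only [exists_prop]
  rfl

theorem build_fst (ξ : Ordinal.{0}) : (build ξ).1 = family bseq ξ := by
  induction ξ using WellFoundedLT.induction with
  | ind ξ ih =>
    rcases Ordinal.zero_or_succ_or_isSuccLimit ξ with rfl | ⟨ζ, rfl⟩ | hξ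
    · rw [family_zero]; simp [build]
    · rw [Order.succ_eq_add_one] at *
      rw [family_succ, ← ih ζ (Order.lt_add_one_iff.2 le_rfl)]
      simp [build]
    · rw [family_limit _ hξ]
      have hb := build_limit hξ
      have h2 : bseq ξ = _ := congrArg Prod.snd hb
      simp only at h2
      rw [congrArg Prod.fst hb]
      simp only
      rw [← h2]
      congr 1
      ext E
      simp only [Set.mem_ofPred_eq]
      refine and_congr_right fun _ => exists_congr fun n => and_congr_right fun _ =>
        and_congr_right fun hl => ?_
      rw [ih _ hl]

theorem bseq_spec (ξ : Ordinal.{0}) : Order.IsSuccLimit ξ → ξ < ω₁ →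
    StrictMono (bseq ξ) ∧ IsLUB (Set.range (bseq ξ)) ξ ∧
      ∀ n, family bseq (bseq ξ n + 1) ⊆ family bseq (bseq ξ (n + 1)) := by
  induction ξ using WellFoundedLT.induction with
  | ind ξ ih =>
    intro hξ hω
    have hg : Good bseq ξ := fun ζ hζ hl => by
      obtain ⟨a, b, -⟩ := ih ζ hζ hl (hζ.trans hω)
      exact ⟨a, b⟩
    have h2 : bseq ξ = _ := congrArg Prod.snd (build_limit hξ)
    simp only [build_fst] at h2
    have key : ∀ c : ℕ+ → Ordinal.{0}, StrictMono c → IsLUB (Set.range c) ξ →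
      ((∀ n, {E | c n + 1 < ξ ∧ E ∈ family bseq (c n + 1)} ⊆
        {E | c (n + 1) < ξ ∧ E ∈ family bseq (c (n + 1))}) ↔
        ∀ n, family bseq (c n + 1) ⊆ family bseq (c (n + 1))) := by
      intro c hs hl
      have hlt := seq_lt hs hl
      refine forall_congr' fun n => ?_
      simp [hlt, hξ.add_one_lt (hlt n)]
    obtain ⟨c, hs, hl, hn⟩ := exists_seq bseq ξ hξ hω hg
    have := Classical.epsilon_spec (p := fun c : ℕ+ → Ordinal.{0} => StrictMono c ∧
      IsLUB (Set.range c) ξ ∧ ∀ n, {E | c n + 1 < ξ ∧ E ∈ family bseq (c n + 1)} ⊆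
        {E | c (n + 1) < ξ ∧ E ∈ family bseq (c (n + 1))}) ⟨c, hs, hl, (key c hs hl).2 hn⟩
    rw [← h2] at this
    exact ⟨this.1, this.2.1, (key _ this.1 this.2.1).1 this.2.2⟩

/-- An admissible choice of fundamental sequences exists. -/
theorem FundamentalSequences.nonempty : Nonempty FundamentalSequences :=
  ⟨⟨bseq, fun ξ h h' => (bseq_spec ξ h h').1, fun ξ h h' => (bseq_spec ξ h h').2.1,
    fun ξ h h' => (bseq_spec ξ h h').2.2⟩⟩

end Schreier

end

noncomputable section

namespace Schreier

/-! ### Minima and enumeration of infinite sets -/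

/-! Every average is a nonnegative mass of total at most 1 on a nonempty initial segment of the set
it is taken from, and the n-th average of `M` is the first average of what remains after n-1
removals (`average_eq_firstAverage`). For ξ ≥ 1 the first average of `N` is the mean of the first m
= min N averages of a lower order: ζ if ξ = ζ+1, and ξ_m if ξ is a limit (`firstAverage_succ`,
`firstAverage_limit`). Removing its support therefore removes m nonempty initial segments in turn,
so the minimum at least doubles.

The core is `hasMassBound`, by transfinite induction on ξ: every F in 𝓢_ξ receives total mass at
most 6. Let p be a lower bound of F. The first average whose support meets F costs at most 1; the
next set starts beyond p, and its average costs at most 1; after that, by doubling, the minimum m is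
at least 2(p+1). It remains to bound this tail by 4 (`IsInitialRule.sum_mass_le_six`).

If ξ = ζ+1, F is a union of p members of 𝓢_ζ. The tail consists of averages of order ζ, taken
consecutively, with weights at most 1/m, so the induction hypothesis gives at most 6p/m ≤ 3. If ξ is
a limit and F ∈ 𝓢_{ξ_p+1}, nestedness puts F in 𝓢_{ξ_m} whenever m > p. One average then gives F at
most 6/m, and doubling sums these bounds geometrically to at most 12/m ≤ 3.

Nonnegativity turns the bounds on partial sums into the first two claims. The same bounds give ‖∑
c_n x_n‖ ≤ 6 for finite sums with |c_n| ≤ 1; choosing c_n to rotate f(x_n) onto |f(x_n)| yields weak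
summability. -/

theorem infinite_setOf_succPNat_mem {M : Set ℕ+} (hM : M.Infinite) :
    (Set.ofPred fun k : ℕ => k.succPNat ∈ M).Infinite := by
  have h : (fun k : ℕ => k.succPNat) '' (Set.ofPred fun k : ℕ => k.succPNat ∈ M) = M := by
    ext a
    constructor
    · rintro ⟨k, hk, rfl⟩
      exact hk
    · intro ha
      exact ⟨a.natPred, by simpa using ha, by simp⟩
  exact Set.Infinite.of_image (fun k : ℕ => k.succPNat) (h.symm ▸ hM)

theorem range_elem {M : Set ℕ+} (hM : M.Infinite) : Set.range (elem M) = M := by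
  have hr := Nat.range_nth_of_infinite (infinite_setOf_succPNat_mem hM)
  ext a
  constructor
  · rintro ⟨n, rfl⟩
    exact Nat.nth_mem_of_infinite (infinite_setOf_succPNat_mem hM) n.natPred
  · intro ha
    have h : a.natPred ∈ Set.ofPred fun k : ℕ => k.succPNat ∈ M := by
      simpa using ha
    rw [← hr] at h
    obtain ⟨n, hn⟩ := h
    exact ⟨n.succPNat, by simp [elem, hn]⟩

theorem strictMono_elem {M : Set ℕ+} (hM : M.Infinite) : StrictMono (elem M) := by
  intro a b hab
  exact Nat.succPNat_strictMono
    (Nat.nth_strictMono (infinite_setOf_succPNat_mem hM) (PNat.natPred_lt_natPred.2 hab))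

theorem minElem_mem {M : Set ℕ+} (hM : M.Infinite) : minElem M ∈ M :=
  (range_elem hM).subset ⟨1, rfl⟩

theorem minElem_le {M : Set ℕ+} (hM : M.Infinite) {a : ℕ+} (ha : a ∈ M) : minElem M ≤ a := by
  rw [← range_elem hM] at ha
  obtain ⟨n, rfl⟩ := ha
  exact (strictMono_elem hM).monotone one_le

theorem elem_diff_minElem {M : Set ℕ+} (hM : M.Infinite) (n : ℕ+) :
    elem (M \ {minElem M}) n = elem M (n + 1) := by
  have hM' : (M \ {minElem M}).Infinite := hM.sdiff (Set.finite_singleton _)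
  have hshift : StrictMono fun n => elem M (n + 1) := fun a b hab =>
    strictMono_elem hM (add_lt_add_left hab 1)
  -- A strictly increasing enumeration is determined by its range, so it suffices to compare ranges.
  refine congrFun (((strictMono_elem hM').range_inj hshift).1 ?_) n
  rw [range_elem hM']
  ext a
  constructor
  · rintro ⟨ha, ha'⟩
    rw [← range_elem hM] at ha
    obtain ⟨k, rfl⟩ := ha
    have hk : k ≠ 1 := by
      rintro rfl
      exact ha' rfl
    obtain ⟨l, rfl⟩ := PNat.exists_eq_succ_of_ne_one hk
    exact ⟨l, rfl⟩
  · rintro ⟨k, rfl⟩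
    refine ⟨(range_elem hM).subset ⟨_, rfl⟩, fun h => ?_⟩
    have h1 : (1 : ℕ+) < k + 1 := by
      rw [add_comm]
      exact PNat.lt_add_right 1 k
    exact (strictMono_elem hM h1).ne' h

/-! ### Peeling off initial segments -/

/-- Remove from `N` the support of `f N`. -/
def peelStep (f : Set ℕ+ → (ℕ+ →₀ ℝ)) (N : Set ℕ+) : Set ℕ+ :=
  N \ ((f N).support : Set ℕ+)

/-- `g` is a nonnegative function of total mass at most `1`, supported on a nonempty initial
segment of `N`. -/
structure IsInitialMass (N : Set ℕ+) (g : ℕ+ →₀ ℝ) : Prop where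
  nonneg : ∀ i, 0 ≤ g i
  nonempty : g.support.Nonempty
  subset : ∀ i ∈ g.support, i ∈ N
  initial : ∀ i ∈ g.support, ∀ j ∈ N, j ≤ i → j ∈ g.support
  sum_le : ∀ F : Finset ℕ+, ∑ i ∈ F, g i ≤ 1

/-- `f` assigns to each infinite set a mass on one of its initial segments. -/
def IsInitialRule (f : Set ℕ+ → (ℕ+ →₀ ℝ)) : Prop :=
  ∀ N : Set ℕ+, N.Infinite → IsInitialMass N (f N)

/-- The average of the first `min N` masses obtained by peeling `N` along `f`. -/
def blockAverage (f : Set ℕ+ → (ℕ+ →₀ ℝ)) (N : Set ℕ+) : ℕ+ →₀ ℝ :=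
  (1 / (minElem N : ℝ)) • ∑ j ∈ Finset.range (minElem N), f ((peelStep f)^[j] N)

theorem infinite_peelStep (f : Set ℕ+ → (ℕ+ →₀ ℝ)) {N : Set ℕ+} (hN : N.Infinite) :
    (peelStep f N).Infinite :=
  hN.sdiff (Finset.finite_toSet _)

theorem infinite_peelStep_iterate (f : Set ℕ+ → (ℕ+ →₀ ℝ)) {N : Set ℕ+} (hN : N.Infinite)
    (n : ℕ) : ((peelStep f)^[n] N).Infinite := by
  induction n with
  | zero => exact hN
  | succ n ih =>
    rw [Function.iterate_succ_apply']
    exact infinite_peelStep f ih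

theorem mem_peelStep_iterate (f : Set ℕ+ → (ℕ+ →₀ ℝ)) (N : Set ℕ+) (n : ℕ) (i : ℕ+) :
    i ∈ (peelStep f)^[n] N ↔ i ∈ N ∧ ∀ k < n, i ∉ (f ((peelStep f)^[k] N)).support := by
  induction n with
  | zero => simp
  | succ n ih =>
    rw [Function.iterate_succ_apply']
    change (i ∈ (peelStep f)^[n] N ∧ i ∉ (f ((peelStep f)^[n] N)).support) ↔ _
    rw [ih, Nat.forall_lt_succ_right, and_assoc]

theorem IsInitialMass.lt_of_mem_diff {N : Set ℕ+} {g : ℕ+ →₀ ℝ} (hg : IsInitialMass N g)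
    {i j : ℕ+} (hi : i ∈ g.support) (hj : j ∈ N \ (g.support : Set ℕ+)) : i < j := by
  by_contra h
  exact hj.2 (hg.initial i hi j hj.1 (not_lt.1 h))

theorem IsInitialMass.lt_minElem_diff {N : Set ℕ+} (hN : N.Infinite) {g : ℕ+ →₀ ℝ}
    (hg : IsInitialMass N g) {i : ℕ+} (hi : i ∈ g.support) :
    i < minElem (N \ (g.support : Set ℕ+)) :=
  hg.lt_of_mem_diff hi (minElem_mem (hN.sdiff (Finset.finite_toSet _)))

/-- Each removal deletes a nonempty initial segment, in particular the current minimum, so the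
minimum grows by at least 1 every time. -/
theorem IsInitialRule.minElem_add_le {f : Set ℕ+ → (ℕ+ →₀ ℝ)} (hf : IsInitialRule f)
    {N : Set ℕ+} (hN : N.Infinite) (n : ℕ) :
    (minElem N : ℕ) + n ≤ minElem ((peelStep f)^[n] N) := by
  induction n with
  | zero => exact le_rfl
  | succ n ih =>
    have hn := infinite_peelStep_iterate f hN n
    obtain ⟨i, hi⟩ := (hf _ hn).nonempty
    have h1 : minElem ((peelStep f)^[n] N) ≤ i := minElem_le hn ((hf _ hn).subset i hi)
    have h2 : i < minElem ((peelStep f)^[n + 1] N) := by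
      rw [Function.iterate_succ_apply']
      exact (hf _ hn).lt_minElem_diff hn hi
    have h3 : (minElem ((peelStep f)^[n] N) : ℕ) < minElem ((peelStep f)^[n + 1] N) :=
      h1.trans_lt h2
    omega

theorem blockAverage_apply (f : Set ℕ+ → (ℕ+ →₀ ℝ)) (N : Set ℕ+) (i : ℕ+) :
    blockAverage f N i =
      (1 / (minElem N : ℝ)) * ∑ j ∈ Finset.range (minElem N), f ((peelStep f)^[j] N) i := by
  simp [blockAverage]

theorem minElem_cast_pos (N : Set ℕ+) : (0 : ℝ) < (minElem N : ℝ) := by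
  exact_mod_cast (minElem N).pos

theorem IsInitialRule.mem_support_blockAverage {f : Set ℕ+ → (ℕ+ →₀ ℝ)} (hf : IsInitialRule f)
    {N : Set ℕ+} (hN : N.Infinite) (i : ℕ+) :
    i ∈ (blockAverage f N).support ↔
      ∃ j < (minElem N : ℕ), i ∈ (f ((peelStep f)^[j] N)).support := by
  have hm := minElem_cast_pos N
  -- Nonnegative terms cannot cancel, so the support of the sum is the union of the supports.
  rw [Finsupp.mem_support_iff, blockAverage_apply, mul_ne_zero_iff,
    and_iff_right (by positivity), Ne, Finset.sum_eq_zero_iff_of_nonneg fun j _ =>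
      (hf _ (infinite_peelStep_iterate f hN j)).nonneg i]
  simp

theorem IsInitialRule.peelStep_blockAverage {f : Set ℕ+ → (ℕ+ →₀ ℝ)} (hf : IsInitialRule f)
    {N : Set ℕ+} (hN : N.Infinite) :
    peelStep (blockAverage f) N = (peelStep f)^[minElem N] N := by
  ext i
  rw [mem_peelStep_iterate]
  change (i ∈ N ∧ i ∉ (blockAverage f N).support) ↔ _
  rw [hf.mem_support_blockAverage hN]
  push Not
  rfl

/-- Removing a block average means min N removals along `f`, each raising the minimum by at least 1.
-/
theorem IsInitialRule.two_mul_minElem_le {f : Set ℕ+ → (ℕ+ →₀ ℝ)} (hf : IsInitialRule f)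
    {N : Set ℕ+} (hN : N.Infinite) :
    2 * (minElem N : ℕ) ≤ minElem (N \ ((blockAverage f N).support : Set ℕ+)) := by
  have h := hf.minElem_add_le hN (minElem N)
  rw [← hf.peelStep_blockAverage hN] at h
  rw [two_mul]
  exact h

theorem IsInitialRule.blockAverage {f : Set ℕ+ → (ℕ+ →₀ ℝ)} (hf : IsInitialRule f) :
    IsInitialRule (blockAverage f) := by
  intro N hN
  have hi := fun n => hf _ (infinite_peelStep_iterate f hN n)
  have hm := minElem_cast_pos N
  refine ⟨fun i => ?_, ?_, fun i h => ?_, fun i h j hj hji => ?_, fun F => ?_⟩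
  · rw [blockAverage_apply]
    exact mul_nonneg (by positivity) (Finset.sum_nonneg fun j _ => (hi j).nonneg i)
  · obtain ⟨i, h⟩ := (hi 0).nonempty
    exact ⟨i, (hf.mem_support_blockAverage hN i).2 ⟨0, (minElem N).pos, h⟩⟩
  · obtain ⟨k, -, hk⟩ := (hf.mem_support_blockAverage hN i).1 h
    exact ((mem_peelStep_iterate f N k i).1 ((hi k).subset i hk)).1
  · obtain ⟨k, hkm, hk⟩ := (hf.mem_support_blockAverage hN i).1 h
    rw [hf.mem_support_blockAverage hN]
    -- Either `j` survives to stage `k`, where the support is initial, or it was removed at an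
    -- earlier stage and lies in that support.
    by_cases hjk : j ∈ (peelStep f)^[k] N
    · exact ⟨k, hkm, (hi k).initial i hk j hjk hji⟩
    · rw [mem_peelStep_iterate] at hjk
      push Not at hjk
      obtain ⟨l, hl, hjl⟩ := hjk hj
      exact ⟨l, hl.trans hkm, hjl⟩
  · simp only [blockAverage_apply]
    rw [← Finset.mul_sum, Finset.sum_comm, one_div, inv_mul_le_iff₀ hm, mul_one]
    refine (Finset.sum_le_sum fun j _ => (hi j).sum_le F).trans ?_
    simp

/-! ### Bounds on the mass of a finite set -/

/-- If the minima at least double at each step, and the total mass of `F` is at most `4` for sets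
starting far enough beyond a lower bound `p` of `F`, then it is always at most `6`. -/
theorem IsInitialRule.sum_mass_le_six {f : Set ℕ+ → (ℕ+ →₀ ℝ)} (hf : IsInitialRule f)
    (hd : ∀ N : Set ℕ+, N.Infinite → 2 * (minElem N : ℕ) ≤ minElem (peelStep f N))
    {F : Finset ℕ+} {p : ℕ} (hp : ∀ a ∈ F, p ≤ (a : ℕ))
    (hF : ∀ N : Set ℕ+, N.Infinite → 2 * (p + 1) ≤ (minElem N : ℕ) → ∀ n : ℕ,
      ∑ k ∈ Finset.range n, ∑ i ∈ F, f ((peelStep f)^[k] N) i ≤ 4)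
    {M : Set ℕ+} (hM : M.Infinite) (n : ℕ) :
    ∑ k ∈ Finset.range n, ∑ i ∈ F, f ((peelStep f)^[k] M) i ≤ 6 := by
  induction n generalizing M with
  | zero => simp
  | succ n ih =>
    have hM' := infinite_peelStep f hM
    rw [Finset.sum_range_succ']
    simp only [Function.iterate_succ_apply, Function.iterate_zero_apply]
    by_cases h : ∃ a ∈ F, a ∈ (f M).support
    · obtain ⟨a, haF, ha⟩ := h
      have h1 : (a : ℕ) < minElem (peelStep f M) := (hf M hM).lt_minElem_diff hM ha
      have h2 := hd _ hM'
      have h3 := hp a haF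
      have h4 := (hf M hM).sum_le F
      cases n with
      | zero => simp only [Finset.range_zero, Finset.sum_empty]; linarith
      | succ n =>
        rw [Finset.sum_range_succ']
        simp only [Function.iterate_succ_apply, Function.iterate_zero_apply]
        have h5 := (hf _ hM').sum_le F
        -- The set left after the first average meeting F has minimum > a ≥ p, hence ≥ p+1; one more
        -- removal doubles this to 2(p+1).
        have h6 := hF _ (infinite_peelStep f hM') (by omega) n
        linarith
    -- The first average misses F and contributes nothing, so the induction hypothesis applies to
    -- the remaining set.
    · push Not at h
      rw [Finset.sum_eq_zero fun i hi => Finsupp.notMem_support_iff.1 (h i hi), add_zero]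
      exact ih hM'

/-- Consecutive block averages use consecutive masses of `f`, none twice. Minima increase, so every
weight is at most 1/m. -/
theorem IsInitialRule.exists_sum_blockAverage_le {f : Set ℕ+ → (ℕ+ →₀ ℝ)} (hf : IsInitialRule f)
    {N : Set ℕ+} (hN : N.Infinite) {m : ℕ+} (hm : m ≤ minElem N) (n : ℕ) :
    ∃ K : ℕ, ∀ i, ∑ k ∈ Finset.range n, Schreier.blockAverage f ((peelStep
      (Schreier.blockAverage f))^[k] N) i ≤
        (1 / (m : ℝ)) * ∑ j ∈ Finset.range K, f ((peelStep f)^[j] N) i := by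
  induction n generalizing N with
  | zero => exact ⟨0, fun i => by simp⟩
  | succ n ih =>
    have hN' := infinite_peelStep (Schreier.blockAverage f) hN
    have hle : m ≤ minElem (peelStep (Schreier.blockAverage f) N) := by
      have h : 2 * (minElem N : ℕ) ≤ minElem (peelStep (Schreier.blockAverage f) N) :=
        hf.two_mul_minElem_le hN
      have h' : (m : ℕ) ≤ minElem N := hm
      rw [← PNat.coe_le_coe]
      omega
    obtain ⟨K, hK⟩ := ih hN' hle
    -- The first block uses min N masses; the remaining blocks use the next `K`.
    refine ⟨minElem N + K, fun i => ?_⟩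
    rw [Finset.sum_range_succ', Finset.sum_range_add, mul_add, add_comm]
    simp only [Function.iterate_succ_apply, Function.iterate_zero_apply]
    refine add_le_add ?_ ?_
    · rw [blockAverage_apply]
      have h0 : (0 : ℝ) < (m : ℝ) := by exact_mod_cast m.pos
      have hm' : (m : ℝ) ≤ (minElem N : ℝ) := by exact_mod_cast hm
      refine mul_le_mul_of_nonneg_right (one_div_le_one_div_of_le h0 hm') ?_
      exact Finset.sum_nonneg fun j _ => (hf _ (infinite_peelStep_iterate f hN j)).nonneg i
    · refine (hK i).trans_eq ?_
      rw [hf.peelStep_blockAverage hN]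
      simp only [← Function.iterate_add_apply, add_comm]

/-! ### The repeated averages as initial rules -/

/-- The first repeated average `𝕊^ξ_{N,1}`, as a function of `N`. -/
def firstAverage (s : FundamentalSequences) (ξ : Ordinal.{0}) (N : Set ℕ+) : ℕ+ →₀ ℝ :=
  average s ξ N 1

theorem firstAverage_zero (s : FundamentalSequences) (N : Set ℕ+) :
    firstAverage s 0 N = Finsupp.single (minElem N) 1 := by
  simp [firstAverage, average, minElem]

theorem average_succ (s : FundamentalSequences) (ζ : Ordinal.{0}) :
    average s (ζ + 1) = peel fun N =>
      (1 / (minElem N : ℝ)) • ∑ j ∈ Finset.Icc 1 (minElem N), average s ζ N j := by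
  simp [average]

theorem average_limit (s : FundamentalSequences) {ξ : Ordinal.{0}} (hl : Order.IsSuccLimit ξ)
    (hξ : ξ < ω₁) :
    average s ξ = peel fun N => firstAverage s (s.seq ξ (minElem N) + 1) N := by
  have hlt : ∀ n, s.seq ξ n + 1 < ξ := fun n =>
    hl.add_one_lt (seq_lt (s.strictMono ξ hl hξ) (s.isLUB ξ hl hξ) n)
  unfold firstAverage
  conv_lhs => unfold average
  rw [Ordinal.limitRecOn_limit _ _ _ _ hl]
  simp only [hlt, dif_pos]
  rfl

theorem peel_one (f : Set ℕ+ → (ℕ+ →₀ ℝ)) (M : Set ℕ+) : peel f M 1 = f M := rfl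

theorem peel_eq (f : Set ℕ+ → (ℕ+ →₀ ℝ)) (M : Set ℕ+) (n : ℕ+) :
    peel f M n = f ((peelStep f)^[n.natPred] M) := rfl

theorem elem_peelStep_iterate (s : FundamentalSequences) {M : Set ℕ+} (hM : M.Infinite) (n : ℕ) :
    minElem ((peelStep (firstAverage s 0))^[n] M) = elem M n.succPNat := by
  induction n generalizing M with
  | zero => rfl
  | succ n ih =>
    rw [Function.iterate_succ_apply, ih (infinite_peelStep _ hM)]
    have h : peelStep (firstAverage s 0) M = M \ {minElem M} := by
      simp [peelStep, firstAverage_zero, Finsupp.support_single]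
    rw [h, elem_diff_minElem hM]
    rfl

/-- For ξ ≥ 1 this unfolds the recursion. At order 0, where the averages are defined through `elem`,
it holds because successively removing minima enumerates `M` in increasing order. -/
theorem average_eq_firstAverage (s : FundamentalSequences) {ξ : Ordinal.{0}} (hξ : ξ < ω₁)
    {M : Set ℕ+} (hM : M.Infinite) (n : ℕ+) :
    average s ξ M n = firstAverage s ξ ((peelStep (firstAverage s ξ))^[n.natPred] M) := by
  rcases Ordinal.zero_or_succ_or_isSuccLimit ξ with rfl | ⟨ζ, rfl⟩ | hl
  · rw [firstAverage_zero, elem_peelStep_iterate s hM]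
    simp [average]
  · rw [Order.succ_eq_add_one]
    have h : firstAverage s (ζ + 1) = fun N =>
        (1 / (minElem N : ℝ)) • ∑ j ∈ Finset.Icc 1 (minElem N), average s ζ N j := by
      funext N
      rw [firstAverage, average_succ, peel_one]
    rw [average_succ, peel_eq, ← h]
    exact (congrFun h _).symm
  · have h : firstAverage s ξ = fun N => firstAverage s (s.seq ξ (minElem N) + 1) N := by
      funext N
      conv_lhs => rw [firstAverage, average_limit s hl hξ, peel_one]
    rw [average_limit s hl hξ, peel_eq, ← h]
    exact (congrFun h _).symm

theorem firstAverage_succ (s : FundamentalSequences) {ζ : Ordinal.{0}} (hζ : ζ < ω₁)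
    {N : Set ℕ+} (hN : N.Infinite) :
    firstAverage s (ζ + 1) N = blockAverage (firstAverage s ζ) N := by
  rw [firstAverage, average_succ, peel_one, blockAverage]
  congr 1
  refine Finset.sum_bij (fun j _ => j.natPred) ?_ ?_ ?_ ?_
  · intro j hj
    have h : (j : ℕ) ≤ minElem N := (Finset.mem_Icc.1 hj).2
    have := j.natPred_add_one
    rw [Finset.mem_range]
    omega
  · intro a _ b _ h
    exact PNat.natPred_injective h
  · intro k hk
    refine ⟨k.succPNat, Finset.mem_Icc.2 ⟨one_le, ?_⟩, by simp⟩
    rw [← PNat.coe_le_coe]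
    exact Nat.succ_le_of_lt (Finset.mem_range.1 hk)
  · intro j _
    exact average_eq_firstAverage s hζ hN j

theorem seq_limit_lt (s : FundamentalSequences) {ξ : Ordinal.{0}} (hl : Order.IsSuccLimit ξ)
    (hξ : ξ < ω₁) (n : ℕ+) : s.seq ξ n < ξ :=
  seq_lt (s.strictMono ξ hl hξ) (s.isLUB ξ hl hξ) n

/-- The order ξ_m + 1 in the limit clause is a successor, so limit orders are also block averages,
but of an order depending on min N. -/
theorem firstAverage_limit (s : FundamentalSequences) {ξ : Ordinal.{0}}
    (hl : Order.IsSuccLimit ξ) (hξ : ξ < ω₁) {N : Set ℕ+} (hN : N.Infinite) :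
    firstAverage s ξ N = blockAverage (firstAverage s (s.seq ξ (minElem N))) N := by
  rw [← firstAverage_succ s ((seq_limit_lt s hl hξ _).trans hξ) hN, firstAverage,
    average_limit s hl hξ, peel_one]

theorem isInitialRule_firstAverage (s : FundamentalSequences) {ξ : Ordinal.{0}} (hξ : ξ < ω₁) :
    IsInitialRule (firstAverage s ξ) := by
  induction ξ using WellFoundedLT.induction with
  | ind ξ ih =>
    intro N hN
    rcases Ordinal.zero_or_succ_or_isSuccLimit ξ with rfl | ⟨ζ, rfl⟩ | hl
    · rw [firstAverage_zero]
      have hs : (Finsupp.single (minElem N) (1 : ℝ)).support = {minElem N} :=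
        Finsupp.support_single _ one_ne_zero
      refine ⟨fun i => ?_, ?_, ?_, ?_, fun F => ?_⟩
      · rw [Finsupp.single_apply]
        split_ifs <;> simp
      · simp
      · intro i hi
        rw [hs, Finset.mem_singleton] at hi
        exact hi ▸ minElem_mem hN
      · intro i hi j hj hji
        rw [hs, Finset.mem_singleton] at hi ⊢
        exact le_antisymm (hi ▸ hji) (minElem_le hN hj)
      · simp only [Finsupp.single_apply]
        rw [Finset.sum_ite_eq]
        split_ifs <;> simp
    · rw [Order.succ_eq_add_one] at *
      have hlt : ζ < ζ + 1 := Order.lt_add_one_iff.2 le_rfl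
      rw [firstAverage_succ s (hlt.trans hξ) hN]
      exact (ih ζ hlt (hlt.trans hξ)).blockAverage N hN
    · rw [firstAverage_limit s hl hξ hN]
      have hlt := seq_limit_lt s hl hξ (minElem N)
      exact (ih _ hlt (hlt.trans hξ)).blockAverage N hN

/-! ### The mass bound, by transfinite induction. -/

/-- Iterates the nestedness condition, using 𝓢_ζ ⊆ 𝓢_{ζ+1} between consecutive steps. -/
theorem family_seq_succ_subset (s : FundamentalSequences) {ξ : Ordinal.{0}}
    (hl : Order.IsSuccLimit ξ) (hξ : ξ < ω₁) {n m : ℕ+} (h : n < m) :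
    family s.seq (s.seq ξ n + 1) ⊆ family s.seq (s.seq ξ m) := by
  induction m using PNat.recOn with
  | one => exact absurd h (not_lt.2 one_le)
  | succ m ih =>
    rcases (PNat.lt_add_one_iff.1 h).eq_or_lt with rfl | hnm
    · exact s.nested ξ hl hξ n
    · refine (ih hnm).trans (Set.Subset.trans ?_ (s.nested ξ hl hξ m))
      rw [family_succ]
      exact fun E => mem_succFamily

/-- The repeated averages of order `ξ` of any infinite set `M` give total mass at most `6` to each
member of `𝓢_ξ`. -/
def HasMassBound (s : FundamentalSequences) (ξ : Ordinal.{0}) : Prop :=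
  ∀ F ∈ s.S ξ, ∀ M : Set ℕ+, M.Infinite → ∀ n : ℕ,
    ∑ k ∈ Finset.range n, ∑ i ∈ F,
      firstAverage s ξ ((peelStep (firstAverage s ξ))^[k] M) i ≤ 6

theorem hasMassBound_zero (s : FundamentalSequences) : HasMassBound s 0 := by
  intro F hF M hM n
  have hS : F ∈ family s.seq 0 := hF
  rw [family_zero] at hS
  rcases hS with rfl | ⟨a, rfl⟩
  · simp
  simp only [Finset.sum_singleton, firstAverage_zero, elem_peelStep_iterate s hM,
    Finsupp.single_apply]
  rw [← Finset.sum_filter, Finset.sum_const, nsmul_eq_mul, mul_one]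
  have hc : (Finset.filter (fun k : ℕ => elem M k.succPNat = a) (Finset.range n)).card ≤ 1 := by
    rw [Finset.card_le_one]
    intro k hk l hl
    have h := (Finset.mem_filter.1 hk).2.trans (Finset.mem_filter.1 hl).2.symm
    exact Nat.succPNat_injective ((strictMono_elem hM).injective h)
  have : ((Finset.filter (fun k : ℕ => elem M k.succPNat = a) (Finset.range n)).card : ℝ) ≤ 1 := by
    exact_mod_cast hc
  linarith

theorem iterate_firstAverage_succ (s : FundamentalSequences) {ζ : Ordinal.{0}} (hζ : ζ < ω₁)
    {N : Set ℕ+} (hN : N.Infinite) (k : ℕ) :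
    (peelStep (firstAverage s (ζ + 1)))^[k] N =
      (peelStep (blockAverage (firstAverage s ζ)))^[k] N := by
  induction k with
  | zero => rfl
  | succ k ih =>
    rw [Function.iterate_succ_apply', Function.iterate_succ_apply', ih, peelStep, peelStep,
      firstAverage_succ s hζ (infinite_peelStep_iterate _ hN k)]

theorem HasMassBound.succ {s : FundamentalSequences} {ζ : Ordinal.{0}} (hζ : ζ < ω₁)
    (hζ' : ζ + 1 < ω₁) (h : HasMassBound s ζ) : HasMassBound s (ζ + 1) := by
  intro F hF M hM n
  have hS : F ∈ family s.seq (ζ + 1) := hF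
  rw [family_succ] at hS
  rcases hS with rfl | ⟨p, P, hP, hp, hlt, rfl⟩
  · simp
  have hi := isInitialRule_firstAverage s hζ
  refine (isInitialRule_firstAverage s hζ').sum_mass_le_six (p := p) ?_ ?_ ?_ hM n
  · intro N hN
    rw [peelStep, firstAverage_succ s hζ hN]
    exact hi.two_mul_minElem_le hN
  · intro a ha
    obtain ⟨i, -, hia⟩ := Finset.mem_biUnion.1 ha
    exact hp i a hia
  · intro N hN hpN n
    obtain ⟨K, hK⟩ := hi.exists_sum_blockAverage_le hN le_rfl n
    have hm := minElem_cast_pos N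
    have hdisj : Set.PairwiseDisjoint (↑(Finset.univ : Finset (Fin p))) P := by
      intro i _ j _ hij
      rw [Function.onFun, Finset.disjoint_left]
      intro a hai haj
      rcases hij.lt_or_gt with h' | h'
      · exact (hlt i j h' a hai a haj).false
      · exact (hlt j i h' a haj a hai).false
    have e : ∀ k, firstAverage s (ζ + 1) ((peelStep (firstAverage s (ζ + 1)))^[k] N) =
        blockAverage (firstAverage s ζ) ((peelStep (blockAverage (firstAverage s ζ)))^[k] N) := by
      intro k
      rw [iterate_firstAverage_succ s hζ hN,
        firstAverage_succ s hζ (infinite_peelStep_iterate _ hN k)]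
    simp only [e]
    rw [Finset.sum_comm]
    refine (Finset.sum_le_sum fun i _ => hK i).trans ?_
    rw [← Finset.mul_sum, Finset.sum_comm]
    simp only [Finset.sum_biUnion hdisj]
    rw [Finset.sum_comm, one_div, inv_mul_le_iff₀ hm]
    -- Each of the p pieces has mass at most 6, and 6p ≤ 4 min N because min N ≥ 2(p+1).
    refine (Finset.sum_le_sum fun i _ => h (P i) (hP i).2 N hN K).trans ?_
    have : 2 * ((p : ℝ) + 1) ≤ (minElem N : ℝ) := by exact_mod_cast hpN
    simp only [Finset.sum_const, Finset.card_univ, Fintype.card_fin, nsmul_eq_mul]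
    linarith

theorem two_mul_minElem_le_limit (s : FundamentalSequences) {ξ : Ordinal.{0}}
    (hl : Order.IsSuccLimit ξ) (hξ : ξ < ω₁) {N : Set ℕ+} (hN : N.Infinite) :
    2 * (minElem N : ℕ) ≤ minElem (peelStep (firstAverage s ξ) N) := by
  rw [peelStep, firstAverage_limit s hl hξ hN]
  exact (isInitialRule_firstAverage s ((seq_limit_lt s hl hξ _).trans hξ)).two_mul_minElem_le hN

/-- Each average gives F at most 6/min of its set, and the minima double: the bound 12/m reproduces
itself as 6/m + 12/(2m). -/
theorem sum_mass_le_div_minElem (s : FundamentalSequences) {ξ : Ordinal.{0}}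
    (hl : Order.IsSuccLimit ξ) (hξ : ξ < ω₁) (h : ∀ ζ < ξ, HasMassBound s ζ)
    {F : Finset ℕ+} {p : ℕ+} (hF : F ∈ family s.seq (s.seq ξ p + 1))
    {N : Set ℕ+} (hN : N.Infinite) (hpN : p < minElem N) (n : ℕ) :
    ∑ k ∈ Finset.range n, ∑ i ∈ F,
      firstAverage s ξ ((peelStep (firstAverage s ξ))^[k] N) i ≤ 12 / (minElem N : ℝ) := by
  have hm := minElem_cast_pos N
  induction n generalizing N with
  | zero =>
    simp only [Finset.range_zero, Finset.sum_empty]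
    positivity
  | succ n ih =>
    have hN' := infinite_peelStep (firstAverage s ξ) hN
    have hd := two_mul_minElem_le_limit s hl hξ hN
    have hp' : p < minElem (peelStep (firstAverage s ξ) N) := by
      rw [← PNat.coe_lt_coe] at hpN ⊢
      omega
    rw [Finset.sum_range_succ']
    simp only [Function.iterate_succ_apply, Function.iterate_zero_apply]
    have h1 := ih hN' hp' (minElem_cast_pos _)
    have h2 : 12 / (minElem (peelStep (firstAverage s ξ) N) : ℝ) ≤ 6 / (minElem N : ℝ) := by
      have hd' : 2 * (minElem N : ℝ) ≤ (minElem (peelStep (firstAverage s ξ) N) : ℝ) := by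
        exact_mod_cast hd
      rw [div_le_div_iff₀ (minElem_cast_pos _) hm]
      linarith
    have h3 : ∑ i ∈ F, firstAverage s ξ N i ≤ 6 / (minElem N : ℝ) := by
      simp only [firstAverage_limit s hl hξ hN, blockAverage_apply]
      rw [← Finset.mul_sum, Finset.sum_comm, one_div, inv_mul_le_iff₀ hm, mul_div_cancel₀ _ hm.ne']
      -- Since p < m = min N, nestedness places F in 𝓢_{ξ_m}, where the induction hypothesis bounds
      -- the m averaged masses.
      exact h _ (seq_limit_lt s hl hξ _) F (family_seq_succ_subset s hl hξ hpN hF) N hN _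
    have h4 : 12 / (minElem N : ℝ) = 6 / (minElem N : ℝ) + 6 / (minElem N : ℝ) := by ring
    linarith

theorem HasMassBound.limit {s : FundamentalSequences} {ξ : Ordinal.{0}}
    (hl : Order.IsSuccLimit ξ) (hξ : ξ < ω₁) (h : ∀ ζ < ξ, HasMassBound s ζ) :
    HasMassBound s ξ := by
  intro F hF M hM n
  have hS : F ∈ family s.seq ξ := hF
  rw [family_limit s.seq hl] at hS
  rcases hS with rfl | ⟨-, p, hp, -, hF'⟩
  · simp
  refine (isInitialRule_firstAverage s hξ).sum_mass_le_six (p := p)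
    (fun N hN => two_mul_minElem_le_limit s hl hξ hN) hp ?_ hM n
  intro N hN hpN n
  have hpm : p < minElem N := by
    rw [← PNat.coe_lt_coe]
    omega
  refine (sum_mass_le_div_minElem s hl hξ h hF' hN hpm n).trans ?_
  have hp1 := p.pos
  -- From p ≥ 1 and min N ≥ 2(p+1); hence 12/min N ≤ 3.
  have h4 : 4 ≤ (minElem N : ℕ) := by omega
  have h4' : (4 : ℝ) ≤ (minElem N : ℝ) := by exact_mod_cast h4
  rw [div_le_iff₀ (minElem_cast_pos N)]
  linarith

theorem hasMassBound (s : FundamentalSequences) {ξ : Ordinal.{0}} (hξ : ξ < ω₁) :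
    HasMassBound s ξ := by
  induction ξ using WellFoundedLT.induction with
  | ind ξ ih =>
    rcases Ordinal.zero_or_succ_or_isSuccLimit ξ with rfl | ⟨ζ, rfl⟩ | hl
    · exact hasMassBound_zero s
    · rw [Order.succ_eq_add_one] at *
      have hlt : ζ < ζ + 1 := Order.lt_add_one_iff.2 le_rfl
      exact (ih ζ hlt (hlt.trans hξ)).succ (hlt.trans hξ) hξ
    · exact HasMassBound.limit hl hξ fun ζ hζ => ih ζ hζ (hζ.trans hξ)

/-! ### Convergence and the bound for the full sum. -/

theorem average_nonneg (s : FundamentalSequences) {ξ : Ordinal.{0}} (hξ : ξ < ω₁)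
    {M : Set ℕ+} (hM : M.Infinite) (n i : ℕ+) : 0 ≤ average s ξ M n i := by
  rw [average_eq_firstAverage s hξ hM]
  exact (isInitialRule_firstAverage s hξ _ (infinite_peelStep_iterate _ hM _)).nonneg i

theorem sum_average_le_six (s : FundamentalSequences) {ξ : Ordinal.{0}} (hξ : ξ < ω₁)
    {M : Set ℕ+} (hM : M.Infinite) {F : Finset ℕ+} (hF : F ∈ s.S ξ) (T : Finset ℕ+) :
    ∑ n ∈ T, ∑ i ∈ F, average s ξ M n i ≤ 6 := by
  -- An arbitrary finite index set is enlarged to an initial range of stages; nonnegativity makes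
  -- this harmless.
  have hsub : T.image PNat.natPred ⊆ Finset.range ((T.image PNat.natPred).sup id + 1) :=
    Finset.subset_range_sup_succ _
  refine le_trans ?_ (hasMassBound s hξ F hF M hM ((T.image PNat.natPred).sup id + 1))
  refine le_trans (le_of_eq ?_) (Finset.sum_le_sum_of_subset_of_nonneg hsub fun k _ _ =>
    Finset.sum_nonneg fun i _ =>
      (isInitialRule_firstAverage s hξ _ (infinite_peelStep_iterate _ hM _)).nonneg i)
  rw [Finset.sum_image PNat.natPred_injective.injOn]
  simp only [average_eq_firstAverage s hξ hM]

theorem summable_average (s : FundamentalSequences) {ξ : Ordinal.{0}} (hξ : ξ < ω₁)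
    {M : Set ℕ+} (hM : M.Infinite) (i : ℕ+) : Summable fun n => average s ξ M n i := by
  -- Singletons belong to 𝓢_ξ, so the mass bound applies to {i}.
  refine summable_of_sum_le (c := 6) (fun n => average_nonneg s hξ hM n i) fun T => ?_
  simpa using sum_average_le_six s hξ hM (s.singleton_mem hξ i) T

theorem sum_abs_fullSum_le_six (s : FundamentalSequences) {ξ : Ordinal.{0}} (hξ : ξ < ω₁)
    {M : Set ℕ+} (hM : M.Infinite) {F : Finset ℕ+} (hF : F ∈ s.S ξ) :
    ∑ i ∈ F, |fullSum s ξ M i| ≤ 6 := by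
  have h : ∀ i, |fullSum s ξ M i| = ∑' n, average s ξ M n i := fun i =>
    abs_of_nonneg (tsum_nonneg fun n => average_nonneg s hξ hM n i)
  simp only [h]
  rw [← Summable.tsum_finsetSum fun i _ => summable_average s hξ hM i]
  exact Real.tsum_le_of_sum_le (fun n => Finset.sum_nonneg fun i _ => average_nonneg s hξ hM n i)
    fun T => sum_average_le_six s hξ hM hF T

/-! ### Weak summability in the Schreier space -/

section Norm

variable (s : FundamentalSequences) {ξ : Ordinal.{0}} (hξ : ξ < ω₁) (𝕜 : Type*) [RCLike 𝕜]

/-- The scalar version of a real finitely supported sequence, as an element of `c₀₀`. -/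
def toC00 (g : ℕ+ →₀ ℝ) : C00 s hξ 𝕜 :=
  show ℕ+ →₀ 𝕜 from g.mapRange (fun a : ℝ => (a : 𝕜)) RCLike.ofReal_zero

theorem averageVec_eq_coe (M : Set ℕ+) (n : ℕ+) :
    averageVec s hξ 𝕜 M n = (toC00 s hξ 𝕜 (average s ξ M n) : X s hξ 𝕜) := by
  have hφ : ∀ x : C00 s hξ 𝕜, (x : X s hξ 𝕜) =
      UniformSpace.Completion.toComplL (𝕜 := 𝕜) x := fun _ => rfl
  have hg : toC00 s hξ 𝕜 (average s ξ M n) = ∑ i ∈ (average s ξ M n).support,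
      (average s ξ M n i : 𝕜) • (show C00 s hξ 𝕜 from Finsupp.single i 1) := by
    have h : (average s ξ M n).mapRange (fun a : ℝ => (a : 𝕜)) RCLike.ofReal_zero =
        ∑ i ∈ (average s ξ M n).support, (average s ξ M n i : 𝕜) • Finsupp.single i (1 : 𝕜) := by
      ext j
      simp only [Finsupp.mapRange_apply, Finsupp.finsetSum_apply, Finsupp.smul_apply,
        Finsupp.single_apply, smul_eq_mul, mul_ite, mul_one, mul_zero, Finset.sum_ite_eq']
      split_ifs with hj
      · rfl
      · rw [Finsupp.notMem_support_iff.1 hj, RCLike.ofReal_zero]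
    exact h
  rw [hg, hφ, map_sum]
  refine Finset.sum_congr rfl fun i _ => ?_
  rw [map_smul]
  rfl

theorem norm_sum_smul_averageVec_le {M : Set ℕ+} (hM : M.Infinite) (T : Finset ℕ+) (c : ℕ+ → 𝕜)
    (hc : ∀ n, ‖c n‖ ≤ 1) : ‖∑ n ∈ T, c n • averageVec s hξ 𝕜 M n‖ ≤ 6 := by
  have hφ : ∀ x : C00 s hξ 𝕜, (x : X s hξ 𝕜) =
      UniformSpace.Completion.toComplL (𝕜 := 𝕜) x := fun _ => rfl
  simp only [averageVec_eq_coe, hφ, ← map_smul]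
  rw [← map_sum, ← hφ, UniformSpace.Completion.norm_coe]
  have : Nonempty (s.S ξ) := ⟨⟨{1}, s.singleton_mem hξ 1⟩⟩
  change schreierNorm s ξ (∑ n ∈ T, c n •
    (average s ξ M n).mapRange (fun a : ℝ => (a : 𝕜)) RCLike.ofReal_zero) ≤ 6
  refine ciSup_le fun E => ?_
  refine le_trans ?_ (sum_average_le_six s hξ hM E.2 T)
  rw [Finset.sum_comm]
  refine Finset.sum_le_sum fun i _ => ?_
  rw [Finsupp.finsetSum_apply]
  refine norm_sum_le_of_le _ fun n _ => ?_
  have h0 := average_nonneg s hξ hM n i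
  rw [Finsupp.smul_apply, Finsupp.mapRange_apply, norm_smul, RCLike.norm_ofReal, abs_of_nonneg h0]
  exact mul_le_of_le_one_left h0 (hc n)

/-- A uniform bound on the norms of finite sums with coefficients in the unit ball gives weak
summability. -/
theorem weaklySummingWith_of_norm_sum_le {E : Type*} [NormedAddCommGroup E] [NormedSpace 𝕜 E]
    {C : ℝ} {x : ℕ+ → E} (h : ∀ (T : Finset ℕ+) (c : ℕ+ → 𝕜), (∀ n, ‖c n‖ ≤ 1) →
      ‖∑ n ∈ T, c n • x n‖ ≤ C) : WeaklySummingWith 𝕜 C x := by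
  intro f hf
  have hb : ∀ T : Finset ℕ+, ∑ n ∈ T, ‖f (x n)‖ ≤ C := by
    intro T
    -- Unimodular scalars with c_n f(x_n) = |f(x_n)| turn the sum of absolute values into one value
    -- of f.
    choose c hc hcf using fun n => RCLike.exists_norm_eq_mul_self (f (x n))
    have h1 : ((∑ n ∈ T, ‖f (x n)‖ : ℝ) : 𝕜) = f (∑ n ∈ T, c n • x n) := by
      simp [map_sum, hcf]
    have h2 : ‖f (∑ n ∈ T, c n • x n)‖ ≤ 1 * ‖∑ n ∈ T, c n • x n‖ := f.le_of_opNorm_le hf _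
    rw [← h1, RCLike.norm_ofReal, one_mul] at h2
    exact (le_abs_self _).trans (h2.trans (h T c fun n => (hc n).le))
  exact ⟨summable_of_sum_le (fun _ => norm_nonneg _) hb,
    Real.tsum_le_of_sum_le (fun _ => norm_nonneg _) hb⟩

end Norm

end Schreier

end

theorem mainTheorem9 (s : Schreier.FundamentalSequences) (ξ : Ordinal.{0}) (hξ : ξ < ω₁)
    (M : Set ℕ+) (hM : M.Infinite) (𝕜 : Type*) [RCLike 𝕜] :
    (∀ i : ℕ+, Summable fun n : ℕ+ => Schreier.average s ξ M n i) ∧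
    (∀ F : Finset ℕ+, F.Nonempty → F ∈ s.S ξ → (F : Set ℕ+) ⊆ M →
      ∑ i ∈ F, |Schreier.fullSum s ξ M i| ≤ 6) ∧
    Schreier.WeaklySummingWith 𝕜 6 (Schreier.averageVec s hξ 𝕜 M) :=
  ⟨Schreier.summable_average s hξ hM,
    fun _ _ hF _ => Schreier.sum_abs_fullSum_le_six s hξ hM hF,
    Schreier.weaklySummingWith_of_norm_sum_le 𝕜 fun T c hc =>
      Schreier.norm_sum_smul_averageVec_le s hξ 𝕜 hM T c hc⟩
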